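/- Let $f:[0,1]\to[0,1]$ be the Farey map, $f(x)=\frac{x}{1-x}$ for $0\le x\le\frac12$ and $f(x)=\frac{1-x}{x}$ for $\frac12\le x\le 1$. For real $\beta$ put $\phi_\beta(x)=-\beta\log|f'(x)|$ and let $$\zeta(z,\beta)=\exp\sum_{n=1}^{\infty}\frac{z^n}{n}\sum_{f^n(x)=x}\exp\sum_{k=0}^{n-1}\phi_\beta(f^k x)$$ be its Ruelle zeta function, regarded as a power series in $z$, where the sum over $f^n(x)=x$ runs over the fixed points of $f^n$ in $[0,1]$. Let $R(\beta)$ be the radius of convergence of this power series; the pressure function of the Farey map is $-\beta F(\beta):=\log\frac{1}{R(\beta)}$. Let $\rho_g=\frac{1+\sqrt5}{2}$ be the golden ratio. Theorem. For every real $\beta$ one has $0<R(\beta)<\infty$, so that the pressure function is well defined and real-valued, and $$-\beta F(\beta)=-2\beta\log\rho_g+o(1)\qquad\text{as }\beta\to-\infty .$$ In particular, for every $\delta>0$ there exists $\beta(\delta)\in\mathbb R$ such that, for all $\beta<\beta(\delta)$, $$-\beta F(\beta)-(-2\beta\log\rho_g)<\delta .$$ -/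

import Mathlib

open Filter Topology

noncomputable section

namespace Farey

/-- The Farey map `f : [0,1] → [0,1]`, `f x = x / (1 - x)` on `[0,1/2]` and `f x = (1 - x) / x` on
`[1/2,1]` (the two formulas agree at `1/2`).  It is written as a function on `ℝ`; only its values
on `[0,1]`, which it maps into itself, are used. -/
def map (x : ℝ) : ℝ := if x ≤ 1 / 2 then x / (1 - x) else (1 - x) / x

/-- The interaction `φ(x) = -β log |f'(x)|`, where `f'` is the derivative on `[0,1]` (one-sided at
the end points).  The only point of `[0,1]` at which `f'` does not exist is `1/2`, which is not
periodic (`1/2 ↦ 1 ↦ 0 ↦ 0`), so that no periodic orbit meets it. -/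
def interaction (β x : ℝ) : ℝ := -β * Real.log |derivWithin map (Set.Icc 0 1) x|

/-- `∑ exp (∑_{k<n} φ(f^k x))`, the outer sum over the fixed points `x` of `f^n` in `[0,1]`.
It is used for `n ≥ 1`, where there are finitely many of them (`2 ^ n`). -/
def periodicSum (β : ℝ) (n : ℕ) : ℝ :=
  ∑ᶠ x ∈ {x : ℝ | x ∈ Set.Icc (0 : ℝ) 1 ∧ map^[n] x = x},
    Real.exp (∑ k ∈ Finset.range n, interaction β (map^[k] x))

/-- The power series `∑_{n ≥ 1} (z ^ n / n) ∑_{f^n x = x} exp (∑_{k<n} φ(f^k x))` in `z`. -/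
def logZeta (β : ℝ) : PowerSeries ℝ :=
  PowerSeries.mk fun n => if n = 0 then 0 else periodicSum β n / n

/-- The series `logZeta β` has no constant term, so it can be substituted into any power series. -/
theorem hasSubst_logZeta (β : ℝ) : PowerSeries.HasSubst (logZeta β) :=
  PowerSeries.HasSubst.of_constantCoeff_zero' (by
    rw [← PowerSeries.coeff_zero_eq_constantCoeff_apply]
    simp [logZeta])

/-- The Ruelle zeta function `ζ(z, β) = exp (∑_{n ≥ 1} (z ^ n / n) ∑_{f^n x = x} …)` of the Farey
map, as a power series in `z`: the exponential series composed with `logZeta β`. -/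
def zeta (β : ℝ) : PowerSeries ℝ := (PowerSeries.exp ℝ).subst (logZeta β)

/-- The radius of convergence of the power series `ζ(z, β)` in the complex variable `z`. -/
def zetaRadius (β : ℝ) : ENNReal :=
  (FormalMultilinearSeries.ofScalars ℂ
    (fun n => ((PowerSeries.coeff n (zeta β) : ℝ) : ℂ))).radius

/-- The pressure function `-β F(β)` of the Farey map: `exp (β F(β))` is the radius of convergence
of the zeta function, so `-β F(β)` is the logarithm of its inverse. -/
def pressure (β : ℝ) : ℝ := -Real.log (zetaRadius β).toReal

end Farey

end

/-!
The radius of convergence of `ζ` is the reciprocal of the exponential growth rate of the sums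
`Zₙ = periodicSum β n`. No analytic continuation is needed: all coefficients of `log ζ` are
nonnegative, and the identity `ζ' = ζ · (log ζ)'` (`succ_mul_coeff_zeta`) bounds the coefficients
of `ζ` from below by `Zₙ / n` (`zetaRadius_le`) and from above by any geometric sequence growing
faster than `Zₙ` (`le_zetaRadius`).

On both branches `|f'| = (1 + f) ^ 2`, so a fixed point `x` of `f^n` contributes `D ^ (-2β)` to
`Zₙ`, where `D = ∏ (1 + f^k x)`. In projective coordinates the inverse branches are the matrices
`step false` and `step true`, and `D` is the eigenvalue, with eigenvector `(x, 1)`, of the product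
of these matrices along the itinerary of `x`. The itinerary determines the fixed point
(`injOn_itinerary`), so `Zₙ` is dominated by sums over words.

The fixed point `ρ - 1 = 1 / ρ` of `f` alone gives `ρ ^ (-2β n) ≤ Zₙ`. For the converse put
`p = -2β > 0`. The functional `height v = v.1 + ρ v.2` is multiplied by exactly `ρ` under
`step true` and by at most `ρ` under `step false`; the latter factor is at most `gap * ρ` with
`gap < 1`, unless `v.1 / v.2 > 3/4`. There both branches are fully expanding, but no word can
stay there: points near `1` go to points near `1/2`, and points come close to `1` only from near
`0`. Accordingly `height ^ p`, doubled near the directions `0` and `1`, is multiplied by at most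
`ρ ^ p (1 + 2 gap ^ p)` under the transfer operator (`supersol_step_add_le`). Hence the pressure
lies between `-2β log ρ` and `-2β log ρ + log (1 + 2 gap ^ (-2β))`, and the last term tends to `0`
as `β → -∞`.
-/

namespace Farey

/-! ### The radius of convergence of the zeta function -/

theorem coeff_zero_zeta (β : ℝ) : PowerSeries.coeff 0 (zeta β) = 1 := by
  rw [zeta, PowerSeries.coeff_subst' (hasSubst_logZeta β), finsum_eq_single _ 0]
  · simp
  · intro d hd
    rw [PowerSeries.coeff_zero_eq_constantCoeff_apply, map_pow,
      ← PowerSeries.coeff_zero_eq_constantCoeff_apply]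
    simp [logZeta, hd]

/-- The coefficientwise form of `ζ' = ζ · (log ζ)'`. -/
theorem succ_mul_coeff_zeta (β : ℝ) (n : ℕ) :
    ((n : ℝ) + 1) * PowerSeries.coeff (n + 1) (zeta β) =
      ∑ p ∈ Finset.HasAntidiagonal.antidiagonal n,
        PowerSeries.coeff p.1 (zeta β) * periodicSum β (p.2 + 1) := by
  have h := congrArg (PowerSeries.coeff n)
    (PowerSeries.derivative_subst (f := PowerSeries.exp ℝ) (hasSubst_logZeta β))
  rw [PowerSeries.derivative_exp, PowerSeries.coeff_derivative, PowerSeries.coeff_mul] at h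
  rw [mul_comm]
  refine h.trans (Finset.sum_congr rfl fun p _ => ?_)
  rw [PowerSeries.coeff_derivative]
  have : (p.2 : ℝ) + 1 ≠ 0 := by positivity
  simp only [logZeta, PowerSeries.coeff_mk, Nat.succ_ne_zero, if_false, zeta]
  push_cast
  rw [div_mul_cancel₀ _ this]

theorem periodicSum_nonneg (β : ℝ) (n : ℕ) : 0 ≤ periodicSum β n :=
  finsum_nonneg fun _ => finsum_nonneg fun _ => (Real.exp_pos _).le

theorem coeff_zeta_nonneg (β : ℝ) (n : ℕ) : 0 ≤ PowerSeries.coeff n (zeta β) := by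
  induction n using Nat.strong_induction_on with
  | _ n ih =>
    rcases n with _ | n
    · simp [coeff_zero_zeta]
    · have h := succ_mul_coeff_zeta β n
      have h0 : 0 ≤ ((n : ℝ) + 1) * PowerSeries.coeff (n + 1) (zeta β) := by
        rw [h]
        refine Finset.sum_nonneg fun p hp => mul_nonneg (ih _ ?_) (periodicSum_nonneg _ _)
        have := Finset.HasAntidiagonal.mem_antidiagonal.1 hp
        omega
      exact nonneg_of_mul_nonneg_right h0 (by positivity)

theorem periodicSum_le_mul_coeff_zeta (β : ℝ) (n : ℕ) :
    periodicSum β (n + 1) ≤ ((n : ℝ) + 1) * PowerSeries.coeff (n + 1) (zeta β) := by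
  rw [succ_mul_coeff_zeta]
  refine le_trans (le_of_eq ?_) (Finset.single_le_sum (a := ((0, n) : ℕ × ℕ))
    (fun p _ => mul_nonneg (coeff_zeta_nonneg β p.1) (periodicSum_nonneg β (p.2 + 1))) (by simp))
  simp [coeff_zero_zeta]

theorem norm_ofScalars_zeta (β : ℝ) (n : ℕ) :
    ‖FormalMultilinearSeries.ofScalars ℂ
      (fun n => ((PowerSeries.coeff n (zeta β) : ℝ) : ℂ)) n‖ = PowerSeries.coeff n (zeta β) := by
  rw [FormalMultilinearSeries.ofScalars_norm, Complex.norm_real,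
    Real.norm_of_nonneg (coeff_zeta_nonneg β n)]

theorem zetaRadius_le {β κ : ℝ} (hκ : 0 < κ) (h : ∀ n, κ ^ (n + 1) ≤ periodicSum β (n + 1)) :
    zetaRadius β ≤ ENNReal.ofReal κ⁻¹ := by
  refine ENNReal.le_of_forall_nnreal_lt fun r hr => ?_
  obtain ⟨C, -, hC⟩ := FormalMultilinearSeries.norm_mul_pow_le_of_lt_radius _ hr
  rw [← ENNReal.ofReal_coe_nnreal]
  refine ENNReal.ofReal_le_ofReal ?_
  by_contra! hlt
  have hy : 1 < κ * r := by
    have := mul_lt_mul_of_pos_left hlt hκ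
    rwa [mul_inv_cancel₀ hκ.ne'] at this
  -- `(κ r) ^ n ≤ C n` for all `n ≥ 1`, against exponential growth
  have hbd : ∀ n : ℕ, (κ * r) ^ (n + 1) ≤ C * ((n + 1 : ℕ) : ℝ) := by
    intro n
    have h1 := hC (n + 1)
    rw [norm_ofScalars_zeta] at h1
    have h2 := (h n).trans (periodicSum_le_mul_coeff_zeta β n)
    calc (κ * r) ^ (n + 1) = κ ^ (n + 1) * (r : ℝ) ^ (n + 1) := mul_pow _ _ _
      _ ≤ ((n : ℝ) + 1) * PowerSeries.coeff (n + 1) (zeta β) * (r : ℝ) ^ (n + 1) := by gcongr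
      _ = ((n : ℝ) + 1) * (PowerSeries.coeff (n + 1) (zeta β) * (r : ℝ) ^ (n + 1)) := by ring
      _ ≤ ((n : ℝ) + 1) * C := by gcongr
      _ = C * ((n + 1 : ℕ) : ℝ) := by push_cast; ring
  have ht := (tendsto_pow_const_div_const_pow_of_one_lt 1 hy).const_mul C
  rw [mul_zero] at ht
  obtain ⟨n, hn⟩ := ((tendsto_add_atTop_iff_nat 1).2 ht |>.eventually
    (gt_mem_nhds (zero_lt_one))).exists
  rw [pow_one, ← mul_div_assoc, div_lt_one (by positivity)] at hn
  exact absurd (hbd n) (not_le.2 hn)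

theorem le_zetaRadius {β κ C : ℝ} (hκ : 0 < κ)
    (h : ∀ n, periodicSum β (n + 1) ≤ C * κ ^ (n + 1)) :
    ENNReal.ofReal κ⁻¹ ≤ zetaRadius β := by
  have hC : 0 ≤ C := nonneg_of_mul_nonneg_left ((periodicSum_nonneg β _).trans (h 0)) (by positivity)
  refine ENNReal.le_of_forall_nnreal_lt fun r hr => ?_
  rw [← ENNReal.ofReal_coe_nnreal, ENNReal.ofReal_lt_ofReal_iff (by positivity)] at hr
  set y : ℝ := κ * r with hy
  have hy0 : 0 ≤ y := by positivity
  have hy1 : y < 1 := by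
    have := mul_lt_mul_of_pos_left hr hκ
    rwa [mul_inv_cancel₀ hκ.ne'] at this
  set b : ℕ → ℝ := fun n => PowerSeries.coeff n (zeta β) * (r : ℝ) ^ n with hb
  have hb0 : ∀ n, 0 ≤ b n := fun n => mul_nonneg (coeff_zeta_nonneg β n) (by positivity)
  obtain ⟨N, hN⟩ := exists_nat_ge (C * (1 - y)⁻¹)
  set A : ℝ := ∑ i ∈ Finset.range (N + 1), b i with hA
  have hA0 : 0 ≤ A := Finset.sum_nonneg fun i _ => hb0 i
  -- past `N` the recursion `n bₙ = ∑ bᵢ Zⱼ rʲ` keeps the bound `A` on all earlier terms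
  have key : ∀ n, b n ≤ A := by
    intro n
    induction n using Nat.strong_induction_on with
    | _ n ih =>
      rcases Nat.lt_or_ge n (N + 1) with hn | hn
      · exact Finset.single_le_sum (fun i _ => hb0 i) (Finset.mem_range.2 hn)
      · obtain ⟨n, rfl⟩ : ∃ m, n = m + 1 := ⟨n - 1, by omega⟩
        have h1 : ((n : ℝ) + 1) * b (n + 1) ≤
            ∑ p ∈ Finset.HasAntidiagonal.antidiagonal n, A * (C * y ^ p.2) := by
          have : ((n : ℝ) + 1) * b (n + 1) = ∑ p ∈ Finset.HasAntidiagonal.antidiagonal n,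
              b p.1 * (periodicSum β (p.2 + 1) * (r : ℝ) ^ (p.2 + 1)) := by
            simp only [hb]
            rw [← mul_assoc, succ_mul_coeff_zeta, Finset.sum_mul]
            refine Finset.sum_congr rfl fun p hp => ?_
            rw [← Finset.HasAntidiagonal.mem_antidiagonal.1 hp]
            ring
          rw [this]
          refine Finset.sum_le_sum fun p hp => ?_
          have hp' := Finset.HasAntidiagonal.mem_antidiagonal.1 hp
          have h2 : periodicSum β (p.2 + 1) * (r : ℝ) ^ (p.2 + 1) ≤ C * y ^ p.2 := by
            calc periodicSum β (p.2 + 1) * (r : ℝ) ^ (p.2 + 1)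
                ≤ C * κ ^ (p.2 + 1) * (r : ℝ) ^ (p.2 + 1) := by gcongr; exact h _
              _ = C * y ^ (p.2 + 1) := by rw [hy]; ring
              _ ≤ C * y ^ p.2 :=
                mul_le_mul_of_nonneg_left (pow_le_pow_of_le_one hy0 hy1.le (Nat.le_succ _)) hC
          exact mul_le_mul (ih _ (by omega)) h2
            (mul_nonneg (periodicSum_nonneg _ _) (by positivity)) hA0
        have h3 : ∑ p ∈ Finset.HasAntidiagonal.antidiagonal n, A * (C * y ^ p.2) ≤ A * (C * (1 - y)⁻¹) := by
          rw [← Finset.mul_sum, ← Finset.mul_sum,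
            Finset.Nat.sum_antidiagonal_eq_sum_range_succ (fun _ j => y ^ j)]
          have hrefl : ∑ k ∈ Finset.range n.succ, y ^ (n - k) = ∑ k ∈ Finset.range (n + 1), y ^ k :=
            Finset.sum_range_reflect (fun k => y ^ k) (n + 1)
          rw [hrefl]
          gcongr
          rw [← tsum_geometric_of_lt_one hy0 hy1]
          exact (summable_geometric_of_lt_one hy0 hy1).sum_le_tsum _ fun i _ => by positivity
        have h4 : A * (C * (1 - y)⁻¹) ≤ A * ((n : ℝ) + 1) := by
          gcongr
          refine hN.trans ?_
          exact_mod_cast (by omega : N ≤ n + 1)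
        have h5 : ((n : ℝ) + 1) * b (n + 1) ≤ ((n : ℝ) + 1) * A := by linarith
        exact le_of_mul_le_mul_left h5 (by positivity)
  refine FormalMultilinearSeries.le_radius_of_bound _ A fun n => ?_
  rw [norm_ofScalars_zeta]
  exact key n

/-! ### The derivative along an orbit -/

theorem map_mem_Icc {x : ℝ} (hx : x ∈ Set.Icc (0 : ℝ) 1) : map x ∈ Set.Icc (0 : ℝ) 1 := by
  obtain ⟨h0, h1⟩ := hx
  unfold map
  split_ifs with h
  · exact ⟨div_nonneg h0 (by linarith), (div_le_one (by linarith)).2 (by linarith)⟩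
  · push Not at h
    exact ⟨div_nonneg (by linarith) h0, (div_le_one (by linarith)).2 (by linarith)⟩

theorem iterate_map_mem_Icc {x : ℝ} (hx : x ∈ Set.Icc (0 : ℝ) 1) (n : ℕ) :
    map^[n] x ∈ Set.Icc (0 : ℝ) 1 := by
  induction n with
  | zero => exact hx
  | succ n ih => rw [Function.iterate_succ_apply']; exact map_mem_Icc ih

theorem map_zero : map 0 = 0 := by norm_num [map]

/-- Both branches of the Farey map satisfy `|f'| = (1 + f) ^ 2`. -/
theorem abs_derivWithin_map {x : ℝ} (hx : x ∈ Set.Icc (0 : ℝ) 1) (hne : x ≠ 1 / 2) :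
    |derivWithin map (Set.Icc 0 1) x| = (1 + map x) ^ 2 := by
  have hu : UniqueDiffWithinAt ℝ (Set.Icc (0 : ℝ) 1) x := uniqueDiffOn_Icc zero_lt_one x hx
  obtain ⟨h0, h1⟩ := hx
  rcases lt_or_gt_of_ne hne with h | h
  · have hd : HasDerivAt (fun x : ℝ => x / (1 - x)) ((1 * (1 - x) - x * (-1)) / (1 - x) ^ 2) x :=
      (hasDerivAt_id x).div ((hasDerivAt_id x).const_sub 1) (by simp; linarith)
    have he : map =ᶠ[𝓝 x] fun x => x / (1 - x) := by
      filter_upwards [Iio_mem_nhds h] with t ht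
      exact if_pos (le_of_lt ht)
    rw [(hd.congr_of_eventuallyEq he).hasDerivWithinAt.derivWithin hu, he.eq_of_nhds]
    have : 1 - x ≠ 0 := by linarith
    rw [abs_of_nonneg (by apply div_nonneg <;> nlinarith)]
    field_simp
    ring
  · have hx0 : x ≠ 0 := by linarith
    have hd : HasDerivAt (fun x : ℝ => (1 - x) / x) (((-1) * x - (1 - x) * 1) / x ^ 2) x :=
      ((hasDerivAt_id x).const_sub 1).div (hasDerivAt_id x) hx0
    have he : map =ᶠ[𝓝 x] fun x => (1 - x) / x := by
      filter_upwards [Ioi_mem_nhds h] with t ht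
      exact if_neg (not_le.2 ht)
    rw [(hd.congr_of_eventuallyEq he).hasDerivWithinAt.derivWithin hu, he.eq_of_nhds]
    rw [abs_of_nonpos (by
      apply div_nonpos_of_nonpos_of_nonneg <;> nlinarith)]
    field_simp
    ring

theorem iterate_map_ne_half {x : ℝ} {n : ℕ} (hn : n ≠ 0) (hx : map^[n] x = x) (k : ℕ) :
    map^[k] x ≠ 1 / 2 := by
  intro hk
  have h0 : map^[k + 2] x = 0 := by
    rw [add_comm, Function.iterate_add_apply, hk]
    norm_num [map]
  have hz : ∀ m, map^[m + (k + 2)] x = 0 := fun m => by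
    rw [Function.iterate_add_apply, h0]
    exact Function.iterate_fixed map_zero m
  -- going round the period `k + 2` times leads back from `0` to `f^k x`
  have hp : map^[n * (k + 2)] x = x := by
    rw [Function.iterate_mul]
    exact Function.iterate_fixed hx _
  have h1 : map^[k + n * (k + 2)] x = 1 / 2 := by rw [Function.iterate_add_apply, hp, hk]
  have h2 : k + n * (k + 2) = (k + (n - 1) * (k + 2)) + (k + 2) := by
    obtain ⟨m, rfl⟩ := Nat.exists_eq_succ_of_ne_zero hn
    simp only [Nat.succ_sub_one, Nat.succ_eq_add_one]
    ring
  rw [h2, hz] at h1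
  norm_num at h1

/-- `∏_{k=1}^{n} (1 + f^k x)`, the square root of `|(f^n)'(x)|`. -/
noncomputable def orbitProd (n : ℕ) (x : ℝ) : ℝ := ∏ k ∈ Finset.range n, (1 + map^[k + 1] x)

theorem orbitProd_succ (n : ℕ) (x : ℝ) :
    orbitProd (n + 1) x = orbitProd n (map x) * (1 + map x) := by
  simp [orbitProd, Finset.prod_range_succ', Function.iterate_succ_apply]

theorem one_le_orbitProd {x : ℝ} (hx : x ∈ Set.Icc (0 : ℝ) 1) (n : ℕ) : 1 ≤ orbitProd n x :=
  calc (1 : ℝ) = ∏ k ∈ Finset.range n, (1 : ℝ) := by simp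
    _ ≤ orbitProd n x := Finset.prod_le_prod (fun _ _ => zero_le_one)
        fun k _ => by linarith [(iterate_map_mem_Icc hx (k + 1)).1]

theorem orbitProd_le_two_pow {x : ℝ} (hx : x ∈ Set.Icc (0 : ℝ) 1) (n : ℕ) :
    orbitProd n x ≤ 2 ^ n := by
  calc orbitProd n x ≤ ∏ k ∈ Finset.range n, (2 : ℝ) :=
        Finset.prod_le_prod (fun k _ => by linarith [(iterate_map_mem_Icc hx (k + 1)).1])
          fun k _ => by linarith [(iterate_map_mem_Icc hx (k + 1)).2]
    _ = 2 ^ n := by simp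

theorem exp_sum_interaction {β x : ℝ} {n : ℕ} (hn : n ≠ 0) (hx : x ∈ Set.Icc (0 : ℝ) 1)
    (hfix : map^[n] x = x) :
    Real.exp (∑ k ∈ Finset.range n, interaction β (map^[k] x)) = orbitProd n x ^ (-2 * β) := by
  have hpos : ∀ k, 0 < 1 + map^[k + 1] x := fun k => by
    linarith [(iterate_map_mem_Icc hx (k + 1)).1]
  rw [Real.rpow_def_of_pos (zero_lt_one.trans_le (one_le_orbitProd hx n)), orbitProd,
    Real.log_prod (fun k _ => (hpos k).ne'), Finset.sum_mul]
  congr 1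
  refine Finset.sum_congr rfl fun k _ => ?_
  rw [interaction, abs_derivWithin_map (iterate_map_mem_Icc hx k) (iterate_map_ne_half hn hfix k),
    ← Function.iterate_succ_apply' map, Real.log_pow]
  push_cast
  ring

/-! ### Coding of periodic points by words -/

/-- The linear action on `ℝ²` of the inverse branches of the Farey map: in the coordinate
`t = v.1 / v.2` it is `t ↦ t / (1 + t)` for `false` and `t ↦ 1 / (1 + t)` for `true`. -/
def step (b : Bool) (v : ℝ × ℝ) : ℝ × ℝ := (if b then v.2 else v.1, v.1 + v.2)

/-- The product of the matrices of `step` along a word, the first letter acting last. -/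
def act : (n : ℕ) → (Fin n → Bool) → ℝ × ℝ → ℝ × ℝ
  | 0, _, v => v
  | n + 1, w, v => step (w 0) (act n (Fin.tail w) v)

/-- The word recording on which side of `1/2` the first `n` points of the orbit of `x` lie. -/
noncomputable def itinerary (n : ℕ) (x : ℝ) : Fin n → Bool := fun k => decide (1 / 2 < map^[k] x)

theorem step_smul (b : Bool) (c : ℝ) (v : ℝ × ℝ) : step b (c • v) = c • step b v := by
  cases b <;> ext <;> simp [step, mul_add]

theorem step_map {x : ℝ} (hx : x ∈ Set.Icc (0 : ℝ) 1) :
    step (decide (1 / 2 < x)) (map x, 1) = (1 + map x) • (x, 1) := by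
  obtain ⟨h0, h1⟩ := hx
  by_cases h : 1 / 2 < x
  · have hm : x * (1 + map x) = 1 := by
      rw [map, if_neg (not_le.2 h)]
      field_simp
      ring
    rw [decide_eq_true h]
    ext
    · simp [step, mul_comm, hm]
    · simp [step, add_comm]
  · have hm : x * (1 + map x) = map x := by
      rw [map, if_pos (not_lt.1 h)]
      have : 1 - x ≠ 0 := by linarith
      field_simp
      ring
    rw [decide_eq_false h]
    ext
    · simp [step, mul_comm, hm]
    · simp [step, add_comm]

theorem act_itinerary {x : ℝ} (hx : x ∈ Set.Icc (0 : ℝ) 1) (n : ℕ) :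
    act n (itinerary n x) (map^[n] x, 1) = orbitProd n x • (x, 1) := by
  induction n generalizing x with
  | zero => simp [act, orbitProd]
  | succ n ih =>
    have ht : Fin.tail (itinerary (n + 1) x) = itinerary n (map x) := by
      ext k
      simp [Fin.tail, itinerary, Function.iterate_succ_apply]
    rw [act, ht, Function.iterate_succ_apply, ih (map_mem_Icc hx), step_smul, orbitProd_succ,
      mul_smul, ← step_map hx]
    rfl

/-- The determinant of two vectors, preserved up to sign by the matrices of `step`. -/
def cross (u v : ℝ × ℝ) : ℝ := u.1 * v.2 - u.2 * v.1

theorem abs_cross_act (n : ℕ) (w : Fin n → Bool) (u v : ℝ × ℝ) :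
    |cross (act n w u) (act n w v)| = |cross u v| := by
  induction n with
  | zero => rfl
  | succ n ih =>
    rw [← ih (Fin.tail w)]
    simp only [act]
    cases w 0
    · congr 1
      simp only [cross, step]
      simp only [Bool.false_eq_true, if_false]
      ring
    · rw [← abs_neg]
      congr 1
      simp only [cross, step, if_true]
      ring

theorem one_lt_orbitProd {x : ℝ} {n : ℕ} (hn : n ≠ 0) (hx : x ∈ Set.Icc (0 : ℝ) 1)
    (hfix : map^[n] x = x) (h0 : 0 < x) : 1 < orbitProd n x := by
  obtain ⟨m, rfl⟩ := Nat.exists_eq_succ_of_ne_zero hn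
  have h1 := one_le_orbitProd hx m
  have : orbitProd (m + 1) x = orbitProd m x * (1 + x) := by
    rw [orbitProd, Finset.prod_range_succ, hfix, orbitProd]
  rw [Nat.succ_eq_add_one, this]
  nlinarith

/-- Two fixed points with the same itinerary span an area that is preserved by the word of that
itinerary, which however multiplies it by the two eigenvalues, at least one of them above `1`. -/
theorem injOn_itinerary {n : ℕ} (hn : n ≠ 0) :
    Set.InjOn (itinerary n) {x : ℝ | x ∈ Set.Icc (0 : ℝ) 1 ∧ map^[n] x = x} := by
  rintro x ⟨hx, hfx⟩ y ⟨hy, hfy⟩ hxy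
  have ax := act_itinerary hx n
  have ay := act_itinerary hy n
  rw [hfx] at ax
  rw [hfy, ← hxy] at ay
  have hc := abs_cross_act n (itinerary n x) (x, 1) (y, 1)
  rw [ax, ay] at hc
  have hc' : cross (orbitProd n x • (x, 1)) (orbitProd n y • (y, 1)) =
      orbitProd n x * orbitProd n y * cross (x, 1) (y, 1) := by
    simp [cross]
    ring
  have h1 := one_le_orbitProd hx n
  have h2 := one_le_orbitProd hy n
  rw [hc', abs_mul, abs_of_pos (by positivity)] at hc
  by_contra hne
  have hpos : 0 < |cross (x, 1) (y, 1)| := by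
    simpa [cross, sub_eq_zero] using hne
  have hprod : orbitProd n x * orbitProd n y = 1 :=
    mul_right_cancel₀ hpos.ne' (by rw [hc, one_mul])
  rcases hx.1.eq_or_lt with h | h
  · have hy0 : 0 < y := lt_of_le_of_ne hy.1 fun h' => hne (h.symm.trans h')
    nlinarith [one_lt_orbitProd hn hy hfy hy0]
  · nlinarith [one_lt_orbitProd hn hx hfx h]

theorem finite_fixedPoints {n : ℕ} (hn : n ≠ 0) :
    {x : ℝ | x ∈ Set.Icc (0 : ℝ) 1 ∧ map^[n] x = x}.Finite :=
  Set.Finite.of_finite_image (Set.toFinite _) (injOn_itinerary hn)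

theorem periodicSum_eq_sum (β : ℝ) {n : ℕ} (hn : n ≠ 0) :
    periodicSum β n = ∑ x ∈ (finite_fixedPoints hn).toFinset, orbitProd n x ^ (-2 * β) := by
  rw [periodicSum, finsum_mem_eq_finite_toFinset_sum _ (finite_fixedPoints hn)]
  refine Finset.sum_congr rfl fun x hx => ?_
  obtain ⟨h1, h2⟩ := (finite_fixedPoints hn).mem_toFinset.1 hx
  exact exp_sum_interaction hn h1 h2

theorem periodicSum_le_sum_words {β : ℝ} {n : ℕ} (hn : n ≠ 0) {G : (Fin n → Bool) → ℝ}
    (hG : ∀ w, 0 ≤ G w)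
    (h : ∀ x ∈ Set.Icc (0 : ℝ) 1, map^[n] x = x → orbitProd n x ^ (-2 * β) ≤ G (itinerary n x)) :
    periodicSum β n ≤ ∑ w, G w := by
  classical
  rw [periodicSum_eq_sum β hn]
  calc _ ≤ ∑ x ∈ (finite_fixedPoints hn).toFinset, G (itinerary n x) :=
        Finset.sum_le_sum fun x hx => by
          obtain ⟨h1, h2⟩ := (finite_fixedPoints hn).mem_toFinset.1 hx
          exact h x h1 h2
    _ = ∑ w ∈ (finite_fixedPoints hn).toFinset.image (itinerary n), G w := by
        rw [Finset.sum_image]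
        simpa using injOn_itinerary hn
    _ ≤ ∑ w, G w := Finset.sum_le_univ_sum_of_nonneg hG

/-! ### Bounds that hold for every temperature -/

theorem pow_le_periodicSum {x : ℝ} (hx : x ∈ Set.Icc (0 : ℝ) 1) (hfix : map x = x) (β : ℝ)
    (n : ℕ) : ((1 + x) ^ (-2 * β)) ^ (n + 1) ≤ periodicSum β (n + 1) := by
  have hit : ∀ k, map^[k] x = x := fun k => Function.iterate_fixed hfix k
  have hD : orbitProd (n + 1) x = (1 + x) ^ (n + 1) := by simp [orbitProd, hit]
  rw [periodicSum_eq_sum β n.succ_ne_zero, Real.rpow_pow_comm (by linarith [hx.1]), ← hD]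
  refine Finset.single_le_sum (f := fun x => orbitProd (n + 1) x ^ (-2 * β)) (fun y hy => ?_)
    ((finite_fixedPoints n.succ_ne_zero).mem_toFinset.2 ⟨hx, hit _⟩)
  have := one_le_orbitProd ((finite_fixedPoints n.succ_ne_zero).mem_toFinset.1 hy).1 (n + 1)
  positivity

theorem periodicSum_le_pow (β : ℝ) (n : ℕ) :
    periodicSum β (n + 1) ≤ 1 * (2 * 2 ^ (2 * |β|)) ^ (n + 1) := by
  refine (periodicSum_le_sum_words n.succ_ne_zero
    (G := fun _ => ((2 : ℝ) ^ (2 * |β|)) ^ (n + 1)) (fun _ => by positivity)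
    fun x hx _ => ?_).trans (le_of_eq ?_)
  · have h1 := one_le_orbitProd hx (n + 1)
    rw [Real.rpow_pow_comm zero_le_two]
    calc orbitProd (n + 1) x ^ (-2 * β) ≤ orbitProd (n + 1) x ^ (2 * |β|) :=
          Real.rpow_le_rpow_of_exponent_le h1 (by linarith [neg_abs_le β])
      _ ≤ _ := Real.rpow_le_rpow (by linarith) (orbitProd_le_two_pow hx _) (by positivity)
  · simp [mul_pow]

/-! ### A supersolution for the transfer operator -/

open Real (goldenRatio)

/-- The linear functional `v ↦ v.1 + ρ v.2`, the left eigenvector of `step true`. -/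
noncomputable def height (v : ℝ × ℝ) : ℝ := v.1 + goldenRatio * v.2

/-- The cone of vectors whose ratio `v.1 / v.2` lies in `[0,1]`. -/
def InCone (v : ℝ × ℝ) : Prop := 0 ≤ v.1 ∧ v.1 ≤ v.2 ∧ 0 < v.2

open Classical in
/-- The weight `2` near the direction `v.1 / v.2 = 1`, where both branches expand `height` by the
full factor `ρ`, and near the direction `0` that `step true` carries there; `1` elsewhere. -/
noncomputable def bump (v : ℝ × ℝ) : ℝ := if 3 * v.1 ≤ v.2 ∨ 3 * v.2 ≤ 4 * v.1 then 2 else 1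

/-- The ratio `(1 + ρ t) / (t + ρ)` at `t = 3/4`. -/
noncomputable def gap : ℝ := (3 * goldenRatio + 4) / (4 * goldenRatio + 3)

theorem gap_pos : 0 < gap := by
  have := Real.goldenRatio_pos
  unfold gap
  positivity

theorem gap_lt_one : gap < 1 := by
  have := Real.one_lt_goldenRatio
  rw [gap, div_lt_one] <;> linarith

/-- A function on the cone, homogeneous of degree `p`, which the transfer operator
`h ↦ h ∘ step false + h ∘ step true` multiplies by at most `ρ ^ p (1 + 2 gap ^ p)`. -/
noncomputable def supersol (p : ℝ) (v : ℝ × ℝ) : ℝ := height v ^ p * bump v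

theorem InCone.step {v : ℝ × ℝ} (hv : InCone v) (b : Bool) : InCone (step b v) := by
  obtain ⟨h0, h1, h2⟩ := hv
  cases b <;> simp [InCone, Farey.step] <;> refine ⟨?_, ?_, ?_⟩ <;> linarith

theorem InCone.act {v : ℝ × ℝ} (hv : InCone v) (n : ℕ) (w : Fin n → Bool) :
    InCone (act n w v) := by
  induction n with
  | zero => exact hv
  | succ n ih => exact (ih _).step _

theorem InCone.height_pos {v : ℝ × ℝ} (hv : InCone v) : 0 < height v := by
  have := mul_pos Real.goldenRatio_pos hv.2.2
  have := hv.1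
  unfold height
  linarith

theorem one_le_bump (v : ℝ × ℝ) : 1 ≤ bump v := by
  unfold bump; split_ifs <;> norm_num

theorem bump_le_two (v : ℝ × ℝ) : bump v ≤ 2 := by
  unfold bump; split_ifs <;> norm_num

theorem height_step_true (v : ℝ × ℝ) : height (step true v) = goldenRatio * height v := by
  simp only [height, step, if_true]
  linear_combination (-v.2) * Real.goldenRatio_sq

theorem height_step_false_le {v : ℝ × ℝ} (hv : InCone v) :
    height (step false v) ≤ goldenRatio * height v := by
  simp only [height, step, Bool.false_eq_true, if_false]
  linear_combination hv.2.1 - v.2 * Real.goldenRatio_sq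

theorem height_step_false_le_gap {v : ℝ × ℝ} (h : 4 * v.1 ≤ 3 * v.2) :
    height (step false v) ≤ gap * (goldenRatio * height v) := by
  have h1 := Real.one_lt_goldenRatio
  have hs := Real.goldenRatio_sq
  have e : height (step false v) = goldenRatio * (goldenRatio * v.1 + v.2) := by
    simp only [height, step, Bool.false_eq_true, if_false]
    linear_combination (-v.1) * hs
  rw [e, mul_left_comm]
  refine mul_le_mul_of_nonneg_left ?_ (by linarith)
  have hgap : gap * (4 * goldenRatio + 3) = 3 * goldenRatio + 4 :=
    div_mul_cancel₀ _ (by linarith)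
  refine le_of_mul_le_mul_right ?_ (by linarith : 0 < 4 * goldenRatio + 3)
  rw [mul_right_comm, hgap, height]
  have := mul_nonneg (by linarith : 0 ≤ goldenRatio) (sub_nonneg.2 h)
  linear_combination this + (4 * v.1 - 3 * v.2) * hs

theorem supersol_step_add_le {p : ℝ} (hp : 0 ≤ p) {v : ℝ × ℝ} (hv : InCone v) :
    supersol p (step false v) + supersol p (step true v) ≤
      goldenRatio ^ p * (1 + 2 * gap ^ p) * supersol p v := by
  have hρ := Real.goldenRatio_pos
  have hN := hv.height_pos
  have hF := (hv.step false).height_pos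
  set X : ℝ := (goldenRatio * height v) ^ p with hX
  have hX0 : 0 < X := by positivity
  have hg : 0 < gap ^ p := Real.rpow_pos_of_pos gap_pos p
  have e : goldenRatio ^ p * (1 + 2 * gap ^ p) * supersol p v = (1 + 2 * gap ^ p) * bump v * X := by
    rw [supersol, hX, Real.mul_rpow hρ.le hN.le]
    ring
  rw [e, supersol, supersol, height_step_true, ← hX]
  obtain ⟨h0, h1, h2⟩ := hv
  by_cases h : 3 * v.2 ≤ 4 * v.1
  · have b0 : bump v = 2 := if_pos (Or.inr h)
    have b1 : bump (step false v) = 1 := if_neg (by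
      simp only [step, Bool.false_eq_true, if_false, not_or, not_le]
      constructor <;> linarith)
    have b2 : bump (step true v) = 1 := if_neg (by
      simp only [step, if_true, not_or, not_le]
      constructor <;> linarith)
    rw [b0, b1, b2]
    have : height (step false v) ^ p ≤ X :=
      Real.rpow_le_rpow hF.le (height_step_false_le ⟨h0, h1, h2⟩) hp
    nlinarith [mul_pos hg hX0]
  · have b2 : bump (step true v) ≤ bump v := by
      by_cases h3 : 3 * v.1 ≤ v.2
      · rw [show bump v = 2 from if_pos (Or.inl h3)]
        exact bump_le_two _
      · rw [show bump (step true v) = 1 from if_neg (by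
          simp only [step, if_true, not_or, not_le]
          constructor <;> linarith)]
        exact one_le_bump v
    have hF' : height (step false v) ^ p ≤ gap ^ p * X := by
      rw [hX, ← Real.mul_rpow gap_pos.le (by positivity)]
      exact Real.rpow_le_rpow hF.le (height_step_false_le_gap (by linarith)) hp
    have hb := one_le_bump v
    calc _ ≤ gap ^ p * X * 2 + X * bump v :=
          add_le_add (mul_le_mul hF' (bump_le_two _) (by linarith [one_le_bump (step false v)])
            (by positivity)) (mul_le_mul_of_nonneg_left b2 hX0.le)
      _ ≤ _ := by nlinarith [mul_pos hg hX0]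

theorem sum_supersol_act_le {p : ℝ} (hp : 0 ≤ p) {v : ℝ × ℝ} (hv : InCone v) (n : ℕ) :
    ∑ w, supersol p (act n w v) ≤ (goldenRatio ^ p * (1 + 2 * gap ^ p)) ^ n * supersol p v := by
  have hρ := Real.goldenRatio_pos
  have hg := gap_pos
  induction n with
  | zero => simp [act]
  | succ n ih =>
    have e : ∑ w, supersol p (act (n + 1) w v) = ∑ w : Fin n → Bool,
        (supersol p (step false (act n w v)) + supersol p (step true (act n w v))) := by
      rw [← (Fin.consEquiv fun _ : Fin (n + 1) => Bool).sum_comp, Fintype.sum_prod_type,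
        Finset.sum_comm]
      refine Finset.sum_congr rfl fun w _ => ?_
      simp [act, Fin.consEquiv, add_comm]
    rw [e]
    calc _ ≤ ∑ w : Fin n → Bool,
          goldenRatio ^ p * (1 + 2 * gap ^ p) * supersol p (act n w v) :=
          Finset.sum_le_sum fun w _ => supersol_step_add_le hp (hv.act n w)
      _ = goldenRatio ^ p * (1 + 2 * gap ^ p) * ∑ w, supersol p (act n w v) := by
          rw [Finset.mul_sum]
      _ ≤ goldenRatio ^ p * (1 + 2 * gap ^ p) *
          ((goldenRatio ^ p * (1 + 2 * gap ^ p)) ^ n * supersol p v) := by gcongr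
      _ = _ := by ring

theorem act_mono (n : ℕ) (w : Fin n → Bool) {u v : ℝ × ℝ} (h : u ≤ v) :
    act n w u ≤ act n w v := by
  induction n with
  | zero => exact h
  | succ n ih =>
    have := ih (Fin.tail w)
    simp only [act, step]
    refine ⟨?_, add_le_add this.1 this.2⟩
    cases w 0
    · exact this.1
    · exact this.2

theorem orbitProd_le_height {x : ℝ} {n : ℕ} (hx : x ∈ Set.Icc (0 : ℝ) 1)
    (hfix : map^[n] x = x) : orbitProd n x ≤ height (act n (itinerary n x) (1, 1)) := by
  have hρ := Real.one_lt_goldenRatio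
  have h1 := one_le_orbitProd hx n
  have ha := act_itinerary hx n
  rw [hfix] at ha
  have hm : act n (itinerary n x) (x, 1) ≤ act n (itinerary n x) (1, 1) :=
    act_mono _ _ ⟨hx.2, le_rfl⟩
  rw [ha] at hm
  obtain ⟨ha1, ha2⟩ := hm
  simp only [Prod.smul_fst, Prod.smul_snd, smul_eq_mul, mul_one] at ha1 ha2
  unfold height
  nlinarith [hx.1]

theorem periodicSum_le_supersol {β : ℝ} (hβ : β ≤ 0) (n : ℕ) :
    periodicSum β (n + 1) ≤ supersol (-2 * β) (1, 1) *
      (goldenRatio ^ (-2 * β) * (1 + 2 * gap ^ (-2 * β))) ^ (n + 1) := by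
  have hc : InCone (1, 1) := ⟨zero_le_one, le_rfl, zero_lt_one⟩
  have hp : 0 ≤ -2 * β := by linarith
  have hle : ∀ w : Fin (n + 1) → Bool, height (act (n + 1) w (1, 1)) ^ (-2 * β) ≤
      supersol (-2 * β) (act (n + 1) w (1, 1)) := fun w =>
    le_mul_of_one_le_right (Real.rpow_nonneg (hc.act _ w).height_pos.le _) (one_le_bump _)
  refine (periodicSum_le_sum_words n.succ_ne_zero
    (G := fun w => supersol (-2 * β) (act (n + 1) w (1, 1)))
    (fun w => (Real.rpow_nonneg (hc.act _ w).height_pos.le _).trans (hle w))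
    fun x hx hfix => ?_).trans ((sum_supersol_act_le hp hc _).trans_eq (mul_comm _ _))
  exact (Real.rpow_le_rpow (by linarith [one_le_orbitProd hx (n + 1)])
    (orbitProd_le_height hx hfix) hp).trans (hle _)

/-! ### The pressure -/

theorem zetaRadius_pos (β : ℝ) : 0 < zetaRadius β :=
  lt_of_lt_of_le (ENNReal.ofReal_pos.2 (by positivity))
    (le_zetaRadius (by positivity) (periodicSum_le_pow β))

theorem zetaRadius_lt_top (β : ℝ) : zetaRadius β < ⊤ :=
  lt_of_le_of_lt (zetaRadius_le (by positivity)
    (pow_le_periodicSum (x := 0) (by simp) map_zero β)) ENNReal.ofReal_lt_top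

theorem map_goldenRatio_sub_one : map (goldenRatio - 1) = goldenRatio - 1 := by
  have hs := Real.goldenRatio_sq
  have h1 := Real.one_lt_goldenRatio
  have h2 : ¬ goldenRatio - 1 ≤ 1 / 2 := by
    intro h
    nlinarith
  rw [map, if_neg h2, div_eq_iff (by linarith)]
  linear_combination -hs

theorem le_pressure (β : ℝ) : -2 * β * Real.log goldenRatio ≤ pressure β := by
  have hρ := Real.goldenRatio_pos
  have h := zetaRadius_le (by rw [add_sub_cancel]; positivity)
    (pow_le_periodicSum ⟨by linarith [Real.one_lt_goldenRatio],
      by linarith [Real.goldenRatio_lt_two]⟩ map_goldenRatio_sub_one β)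
  rw [add_sub_cancel] at h
  have h' := ENNReal.toReal_mono ENNReal.ofReal_ne_top h
  rw [ENNReal.toReal_ofReal (by positivity)] at h'
  have := Real.log_le_log
    (ENNReal.toReal_pos (zetaRadius_pos β).ne' (zetaRadius_lt_top β).ne) h'
  rw [Real.log_inv, Real.log_rpow hρ] at this
  unfold pressure
  linarith

theorem pressure_le {β : ℝ} (hβ : β ≤ 0) :
    pressure β ≤ -2 * β * Real.log goldenRatio + Real.log (1 + 2 * gap ^ (-2 * β)) := by
  have hρ := Real.goldenRatio_pos
  have hg := gap_pos
  have h := le_zetaRadius (by positivity) (periodicSum_le_supersol hβ)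
  have h' := ENNReal.toReal_mono (zetaRadius_lt_top β).ne h
  rw [ENNReal.toReal_ofReal (by positivity)] at h'
  have := Real.log_le_log (by positivity) h'
  rw [Real.log_inv, Real.log_mul (by positivity) (by positivity), Real.log_rpow hρ] at this
  unfold pressure
  linarith

theorem tendsto_pressure_sub :
    Tendsto (fun β : ℝ => pressure β - (-2 * β * Real.log goldenRatio)) atBot (𝓝 0) := by
  have hlin : Tendsto (fun β : ℝ => -2 * β) atBot atTop :=
    tendsto_id.const_mul_atBot_of_neg (by norm_num)
  have hpow : Tendsto (fun β : ℝ => gap ^ (-2 * β)) atBot (𝓝 0) :=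
    (tendsto_rpow_atTop_of_base_lt_one gap (by linarith [gap_pos]) gap_lt_one).comp hlin
  have hlog : Tendsto (fun β : ℝ => Real.log (1 + 2 * gap ^ (-2 * β))) atBot (𝓝 0) := by
    have := ((hpow.const_mul 2).const_add 1).log (by norm_num)
    simpa using this
  refine tendsto_of_tendsto_of_tendsto_of_le_of_le' tendsto_const_nhds hlog
    (Eventually.of_forall fun β => sub_nonneg.2 (le_pressure β)) ?_
  filter_upwards [eventually_le_atBot 0] with β hβ
  linarith [pressure_le hβ]

end Farey

theorem mainTheorem6 :
    (∀ β : ℝ, 0 < Farey.zetaRadius β ∧ Farey.zetaRadius β < ⊤) ∧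
    Tendsto (fun β : ℝ => Farey.pressure β - (-2 * β * Real.log Real.goldenRatio)) atBot (𝓝 0) ∧
    (∀ δ : ℝ, 0 < δ → ∃ β₀ : ℝ, ∀ β : ℝ, β < β₀ →
      Farey.pressure β - (-2 * β * Real.log Real.goldenRatio) < δ) := by
  refine ⟨fun β => ⟨Farey.zetaRadius_pos β, Farey.zetaRadius_lt_top β⟩,
    Farey.tendsto_pressure_sub, fun δ hδ => ?_⟩
  obtain ⟨β₀, h⟩ := eventually_atBot.1
    (Farey.tendsto_pressure_sub.eventually (gt_mem_nhds hδ))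
  exact ⟨β₀, fun β hβ => h β hβ.le⟩
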